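/- Let $k\ge 2$, and let $(G,S,T)$ be a network with $2k-1$ sources and $2k-1$ sinks. That is, $G=(V,E,\omega)$ is a finite directed acyclic graph with $E\subseteq V\times V$ and edge weights $\omega:E\to\mathbb{R}_{>0}$, planarly embedded in a closed disc (vertices are distinct points, edges are simple arcs that meet each other and the vertices only at common ends, and meet the boundary of the disc only at vertices), and $S=(s_1,\dots,s_{2k-1})$, $T=(t_1,\dots,t_{2k-1})$ are tuples of vertices, repetitions allowed, such that $s_1,\dots,s_{2k-1},t_{2k-1},\dots,t_1$ lie in (weakly) clockwise order on the boundary of the disc. A path connecting $v_0$ to $v_n$ ($n\ge 0$) is a sequence $\pi=(v_0,\dots,v_n)$ of distinct vertices with $(v_{i-1},v_i)\in E$ for $1\le i\le n$; write $\mathrm{Vert}(\pi)=\{v_0,\dots,v_n\}$ and $\mathrm{wt}(\pi)=\prod_{i=1}^n\omega(v_{i-1},v_i)$. Call $U\subseteq V$ non-returning if $\mathrm{Vert}(\pi)\subseteq U$ for every path $\pi$ connecting two elements of $U$, and sink-branching if for all $u\in U$, $i\in\{2,\dots,2k-2\}$, $j\in\{1,2k-1\}$ and all paths $\pi'$ connecting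 $u$ to $t_i$ and $\pi''$ connecting $u$ to $t_j$ one has $\mathrm{Vert}(\pi')\cap\mathrm{Vert}(\pi'')=\{u\}$. Suppose that the network is interlacing, i.e. 1. ($k$-bottlenecked) there is a non-returning $N\subseteq V$ with $|N|\le k$ such that for all $i,j\in\{1,\dots,2k-1\}$ every path connecting $s_i$ to $t_j$ contains a vertex of $N$; and 2. ($(k-1)$-sink-bottlenecked) there is a non-returning and sink-branching $N_T\subseteq V$ with $|N_T|\le k-1$ such that for all $i\in\{1,\dots,2k-1\}$ and $j\in\{2,\dots,2k-2\}$ every path connecting $s_i$ to $t_j$ contains a vertex of $N_T$. Let $P_G$ be the $(2k-1)\times(2k-1)$ path matrix, whose $(i,j)$ entry is $\sum_\pi\mathrm{wt}(\pi)$, the sum over all paths $\pi$ connecting $s_i$ to $t_j$. Then $P_G$ is an interlacing matrix: all its minors are nonnegative, its rank is at most $k$, and the submatrix formed by its columns $2,\dots,2k-2$ has rank at most $k-1$. -/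

import Mathlib

open scoped unitInterval

/-- An edge-weighted directed acyclic graph on the vertex set `V`, with edge set
`{(u, v) | Adj u v} ⊆ V × V` and positive real weights on the edges. (Only the values of
`weight` on edges are ever used. Finiteness of `V` is a hypothesis where it is needed,
planarity is part of `Network`.) -/
structure WeightedDag (V : Type*) where
  Adj : V → V → Prop
  weight : V → V → ℝ
  weight_pos : ∀ u v, Adj u v → 0 < weight u v
  acyclic : ∀ v, ¬ Relation.TransGen Adj v v

namespace WeightedDag

variable {V : Type*}

/-- A path connecting `u` to `v`: a nonempty sequence of distinct vertices, starting at `u` and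
ending at `v`, in which consecutive vertices are joined by edges. -/
@[ext]
structure DiPath (G : WeightedDag V) (u v : V) where
  verts : List V
  nodup : verts.Nodup
  isChain : verts.IsChain G.Adj
  head_eq : verts.head? = some u
  last_eq : verts.getLast? = some v

/-- The set of vertices of a path. -/
def DiPath.vert {G : WeightedDag V} {u v : V} (π : G.DiPath u v) : Set V :=
  {w | w ∈ π.verts}

/-- The weight of a path: the product of the weights of its edges. -/
def DiPath.wt {G : WeightedDag V} {u v : V} (π : G.DiPath u v) : ℝ :=
  (List.zipWith G.weight π.verts π.verts.tail).prod

instance DiPath.instFinite [Finite V] (G : WeightedDag V) (u v : V) : Finite (G.DiPath u v) := by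
  classical
  have := Fintype.ofFinite V
  exact Finite.of_injective
    (fun π : G.DiPath u v => (⟨π.verts, π.nodup⟩ : {l : List V // l.Nodup}))
    (fun π π' h => DiPath.ext (congrArg Subtype.val h))

noncomputable instance DiPath.instFintype [Finite V] (G : WeightedDag V) (u v : V) :
    Fintype (G.DiPath u v) :=
  Fintype.ofFinite _

/-- A planar embedding of the graph in the closed unit disc: the vertices are distinct points
of the disc, every edge is a simple arc in the disc between the points of its ends, an arc meets
the boundary circle at most in its ends, its interior contains no vertex, and the interiors of
different arcs are disjoint. -/
structure DiscEmbedding (G : WeightedDag V) where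
  pos : V → ℂ
  pos_injective : Function.Injective pos
  norm_pos_le : ∀ v, ‖pos v‖ ≤ 1
  arc : ∀ u v, G.Adj u v → Path (pos u) (pos v)
  arc_injective : ∀ u v (h : G.Adj u v), Function.Injective (arc u v h)
  norm_arc_lt : ∀ u v (h : G.Adj u v) (x : I), 0 < x → x < 1 → ‖arc u v h x‖ < 1
  arc_ne_pos : ∀ u v (h : G.Adj u v) (x : I), 0 < x → x < 1 → ∀ w, arc u v h x ≠ pos w
  arc_disjoint : ∀ u v (h : G.Adj u v) u' v' (h' : G.Adj u' v') (x y : I),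
    0 < x → x < 1 → 0 < y → y < 1 → arc u v h x = arc u' v' h' y → u = u' ∧ v = v'

end WeightedDag

/-- A network with `2k-1` sources and `2k-1` sinks, embedded in a disc such that
`s_1, …, s_{2k-1}, t_{2k-1}, …, t_1` are arranged in (weakly) clockwise order on the boundary
circle. The order is expressed by arguments
`a_1 ≥ ⋯ ≥ a_{2k-1} ≥ b_{2k-1} ≥ ⋯ ≥ b_1 ≥ a_1 - 2π` of these points; vertices may be repeated.
The index `i : Fin (2 * k - 1)` stands for the number `i + 1` in `{1, …, 2k-1}`. -/
structure Network (V : Type*) (k : ℕ) extends WeightedDag V where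
  source : Fin (2 * k - 1) → V
  sink : Fin (2 * k - 1) → V
  embedding : toWeightedDag.DiscEmbedding
  clockwise : ∃ a b : Fin (2 * k - 1) → ℝ,
    (∀ i, embedding.pos (source i) = Complex.exp (a i * Complex.I)) ∧
    (∀ j, embedding.pos (sink j) = Complex.exp (b j * Complex.I)) ∧
    Antitone a ∧ Monotone b ∧
    (∀ i j, b j ≤ a i) ∧ (∀ i j, a i - 2 * Real.pi ≤ b j)

/-- The index `j` stands for an element of `{2, …, 2k-2}`. -/
abbrev IsMiddleIndex (k : ℕ) (j : Fin (2 * k - 1)) : Prop :=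
  2 ≤ (j : ℕ) + 1 ∧ (j : ℕ) + 1 ≤ 2 * k - 2

/-- The index `j` stands for an element of `{1, 2k-1}`. -/
abbrev IsEndIndex (k : ℕ) (j : Fin (2 * k - 1)) : Prop :=
  (j : ℕ) + 1 = 1 ∨ (j : ℕ) + 1 = 2 * k - 1

namespace Network

variable {V : Type*} {k : ℕ}

/-- `U` is non-returning: every path between two vertices of `U` stays in `U`. -/
def NonReturning (N : Network V k) (U : Finset V) : Prop :=
  ∀ u₁ ∈ U, ∀ u₂ ∈ U, ∀ π : N.DiPath u₁ u₂, π.vert ⊆ (U : Set V)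

/-- `U` is sink-branching: a path from `u ∈ U` to one of the sinks `t_2, …, t_{2k-2}` and a path
from `u` to `t_1` or `t_{2k-1}` have only the vertex `u` in common. -/
def SinkBranching (N : Network V k) (U : Finset V) : Prop :=
  ∀ u ∈ U, ∀ i j, IsMiddleIndex k i → IsEndIndex k j →
    ∀ (π' : N.DiPath u (N.sink i)) (π'' : N.DiPath u (N.sink j)), π'.vert ∩ π''.vert = {u}

/-- The network is `k`-bottlenecked. -/
def IsBottlenecked (N : Network V k) : Prop :=
  ∃ U : Finset V, N.NonReturning U ∧ U.card ≤ k ∧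
    ∀ i j, ∀ π : N.DiPath (N.source i) (N.sink j), ∃ v ∈ π.vert, v ∈ U

/-- The network is `(k-1)`-sink-bottlenecked. -/
def IsSinkBottlenecked (N : Network V k) : Prop :=
  ∃ U : Finset V, N.NonReturning U ∧ N.SinkBranching U ∧ U.card ≤ k - 1 ∧
    ∀ i j, IsMiddleIndex k j →
      ∀ π : N.DiPath (N.source i) (N.sink j), ∃ v ∈ π.vert, v ∈ U

/-- The network is interlacing. -/
def IsInterlacing (N : Network V k) : Prop :=
  N.IsBottlenecked ∧ N.IsSinkBottlenecked

/-- The path matrix: its entry at `i, j` is the sum of the weights of all paths connecting the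
`i`-th source to the `j`-th sink. -/
noncomputable def pathMatrix [Finite V] (N : Network V k) :
    Matrix (Fin (2 * k - 1)) (Fin (2 * k - 1)) ℝ :=
  Matrix.of fun i j => ∑ π : N.DiPath (N.source i) (N.sink j), π.wt

end Network

/-- A real matrix is totally nonnegative if all its minors are nonnegative. -/
def IsTotallyNonneg {m n : ℕ} (A : Matrix (Fin m) (Fin n) ℝ) : Prop :=
  ∀ (r : ℕ) (f : Fin r → Fin m) (g : Fin r → Fin n), StrictMono f → StrictMono g →
    0 ≤ (A.submatrix f g).det

/-- An interlacing matrix of order `2k-1` (for `k ≥ 2`): totally nonnegative, of rank at most `k`,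
and such that the submatrix of the columns `2, …, 2k-2` has rank at most `k-1`. -/
def IsInterlacingMatrix (k : ℕ) (A : Matrix (Fin (2 * k - 1)) (Fin (2 * k - 1)) ℝ) : Prop :=
  IsTotallyNonneg A ∧ A.rank ≤ k ∧
    (A.submatrix id (fun j : {j : Fin (2 * k - 1) // IsMiddleIndex k j} => j.1)).rank ≤ k - 1

/-! Two independent mechanisms give the result. Nonnegativity of minors is the
Lindström–Gessel–Viennot argument. A minor is a signed sum over families of walks, and exchanging
tails at a common vertex cancels the families that meet (`det_sum_walks`). In a surviving family the
walks are pairwise disjoint. An inversion of its permutation would give two walks whose ends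
alternate on the circle; by planarity these share a vertex (`exists_mem_of_alternating_ends`). Hence
only the identity contributes, with positive sign. The topological input,
`exists_eq_of_alternating_ends`, is a winding number computation: for curves `f`, `g` that never
meet, `f s - g t` would have a continuous logarithm on the plane, yet its argument changes by `2π`
around the unit square. The rank bounds come from cutting each walk at its first vertex in a
bottleneck `U`: the matrix of walk sums factors through `ℝ^U` (`rank_sum_walks_le`). This applies to
the whole path matrix and to its middle columns. -/

namespace Complex

/-! ### Crossing curves in the disc, by arguments of differences -/

/-- A continuous logarithm of a function with values in an open half-plane differs from the
principal one by a constant. -/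
theorem sub_eq_log_sub_log {θ : ℝ → ℂ} (hθ : Continuous θ) {c : ℂ} (hc : c ≠ 0)
    (h : ∀ t, 0 < (exp (θ t) / c).re) (s t : ℝ) :
    θ t - θ s = log (exp (θ t) / c) - log (exp (θ s) / c) := by
  have hcont : Continuous fun t => θ t - log (exp (θ t) / c) := by
    refine hθ.sub (continuous_iff_continuousAt.2 fun t => ?_)
    exact ContinuousAt.clog (by fun_prop) (Or.inl (h t))
  have hexp : ∀ t, exp (θ t - log (exp (θ t) / c)) = c := fun t => by
    rw [exp_sub, exp_log (div_ne_zero (exp_ne_zero _) hc)]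
    field_simp [exp_ne_zero]
  -- `θ - log` is a continuous map into one fibre of the covering `exp`, hence constant.
  have := congrFun (isCoveringMap_exp.eq_of_comp_eq hcont
    (continuous_const (y := θ s - log (exp (θ s) / c)))
    (funext fun t => Subtype.ext ((hexp t).trans (hexp s).symm)) s rfl) t
  linear_combination this

/-- With `δ = β - α`, `1 - e^{iδ} = 2 sin(δ/2) e^{i(δ-π)/2}`. Since `δ` lies in `(0, 2π)`, the
modulus is positive and the angle is principal. -/
theorem arg_sub_div_exp {α β : ℝ} (h₀ : α < β) (h₁ : β < α + 2 * Real.pi) :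
    arg ((exp (α * Complex.I) - exp (β * Complex.I)) / exp (α * Complex.I)) = (β - α - Real.pi) / 2 := by
  have key : (exp (α * Complex.I) - exp (β * Complex.I)) / exp (α * Complex.I) =
      ((2 * Real.sin ((β - α) / 2) : ℝ) : ℂ) *
        (cos (((β - α - Real.pi) / 2 : ℝ) : ℂ) + sin (((β - α - Real.pi) / 2 : ℝ) : ℂ) * Complex.I) := by
    have e : (β - α - Real.pi) / 2 = (β - α) / 2 - Real.pi / 2 := by ring
    rw [sub_div, div_self (exp_ne_zero _), ← exp_sub, e, ← ofReal_cos, ← ofReal_sin,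
      Real.cos_sub_pi_div_two, Real.sin_sub_pi_div_two]
    have e2 : (β : ℂ) * Complex.I - α * Complex.I = ((2 * ((β - α) / 2) : ℝ) : ℂ) * Complex.I := by push_cast; ring
    rw [e2, exp_mul_I, ← ofReal_cos, ← ofReal_sin, Real.cos_two_mul, Real.sin_two_mul,
      Real.cos_sq']
    push_cast
    ring
  rw [key, arg_mul_cos_add_sin_mul_I]
  · have := Real.sin_pos_of_pos_of_lt_pi (x := (β - α) / 2) (by linarith) (by linarith)
    linarith
  · constructor <;> linarith [Real.pi_pos]

/-- The disc touches its tangent at `p` only in `p`. So `p - z` stays in an open half-plane, where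
the principal logarithm is continuous. -/
theorem re_sub_div_pos {p z : ℂ} (hp : ‖p‖ = 1) (hz : ‖z‖ ≤ 1) (hne : z ≠ p) :
    0 < ((p - z) / p).re := by
  have hp0 : p ≠ 0 := norm_ne_zero_iff.1 (by rw [hp]; exact one_ne_zero)
  rw [sub_div, div_self hp0, sub_re, one_re, sub_pos]
  have hn : ‖z / p‖ ≤ 1 := by rwa [norm_div, hp, div_one]
  refine lt_of_le_of_ne ((re_le_norm _).trans hn) fun h => hne ?_
  have him : (z / p).im = 0 := by
    have := normSq_apply (z / p)
    rw [normSq_eq_norm_sq] at this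
    nlinarith [norm_nonneg (z / p), sq_nonneg (z / p).im]
  have : z / p = 1 := Complex.ext h him
  rwa [div_eq_one_iff_eq hp0] at this

/-- The change of a continuous argument of `p - γ`, where `p` is a point of the unit circle and
`γ` a curve in the closed unit disc that avoids `p`. -/
theorem im_sub_im_of_exp_eq_sub {θ γ : ℝ → ℂ} (hθ : Continuous θ) {α β₀ β₁ : ℝ} {c : ℂ}
    (hc : c ≠ 0) (h : ∀ t, exp (θ t) = c * (exp (α * Complex.I) - γ t))
    (hγ : ∀ t, ‖γ t‖ ≤ 1) (hne : ∀ t, γ t ≠ exp (α * Complex.I))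
    (h₀ : γ 0 = exp (β₀ * Complex.I)) (h₁ : γ 1 = exp (β₁ * Complex.I))
    (hβ₀ : α < β₀) (hβ₀' : β₀ < α + 2 * Real.pi) (hβ₁ : α < β₁) (hβ₁' : β₁ < α + 2 * Real.pi) :
    (θ 1).im - (θ 0).im = (β₁ - β₀) / 2 := by
  have e : ∀ t, exp (θ t) / (c * exp (α * Complex.I)) = (exp (α * Complex.I) - γ t) / exp (α * Complex.I) := fun t => by
    rw [h, mul_div_mul_left _ _ hc]
  have := congrArg im (sub_eq_log_sub_log hθ (mul_ne_zero hc (exp_ne_zero _))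
    (fun t => by rw [e]; exact re_sub_div_pos (norm_exp_ofReal_mul_I α) (hγ t) (hne t)) 0 1)
  rw [sub_im, sub_im, log_im, log_im, e, e, h₀, h₁, arg_sub_div_exp hβ₁ hβ₁',
    arg_sub_div_exp hβ₀ hβ₀'] at this
  rw [this]
  ring

/-- Two curves in the closed unit disc whose ends alternate on the unit circle meet. -/
theorem exists_eq_of_alternating_ends {α₁ α₂ α₃ α₄ : ℝ} (h₂₁ : α₂ < α₁) (h₃₂ : α₃ < α₂)
    (h₄₃ : α₄ < α₃) (h₁₄ : α₁ - 2 * Real.pi < α₄)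
    (f : Path (exp (α₁ * Complex.I)) (exp (α₃ * Complex.I))) (g : Path (exp (α₂ * Complex.I)) (exp (α₄ * Complex.I)))
    (hf : ∀ x, ‖f x‖ ≤ 1) (hg : ∀ x, ‖g x‖ ≤ 1) : ∃ x y, f x = g y := by
  by_contra! hne
  have hf' : ∀ s, ‖f.extend s‖ ≤ 1 := fun s => hf _
  have hg' : ∀ s, ‖g.extend s‖ ≤ 1 := fun s => hg _
  have hne' : ∀ s t, f.extend s ≠ g.extend t := fun s t => hne _ _
  obtain ⟨θ, hθ, hexp⟩ := exists_continuousOn_eqOn_exp_comp (X := ℝ × ℝ) (U := Set.univ)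
    (by
      have := convex_univ (𝕜 := ℝ) (E := ℝ × ℝ) |>.contractibleSpace Set.univ_nonempty
      exact SimplyConnectedSpace.ofContractible _) isOpen_univ
    (g := fun x => f.extend x.1 - g.extend x.2) (by fun_prop)
    (by rintro ⟨x, -, hx⟩; exact hne' _ _ (sub_eq_zero.1 hx))
  rw [continuousOn_univ] at hθ
  have hexp' : ∀ s t, exp (θ (s, t)) = f.extend s - g.extend t :=
    fun s t => hexp (Set.mem_univ (s, t))
  have hf0 : f.extend 0 = exp (α₁ * Complex.I) := f.extend_zero
  have hf1 : f.extend 1 = exp (α₃ * Complex.I) := f.extend_one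
  have hg0 : g.extend 0 = exp (α₂ * Complex.I) := g.extend_zero
  have hg1 : g.extend 1 = exp (α₄ * Complex.I) := g.extend_one
  have period : ∀ β : ℝ, exp (β * Complex.I) = exp ((β + 2 * Real.pi : ℝ) * Complex.I) := fun β => by
    push_cast
    rw [add_mul, exp_add, exp_two_pi_mul_I, mul_one]
  -- One identity for each side of the unit square. On each side one curve rests at an end with
  -- argument `α`, and the ends of the other get arguments in `(α, α + 2π)`, which decides where
  -- `2π` is added. Here `c` is `1` or `-1` according to whether the resting curve is `f` or `g`.
  have e₁ := im_sub_im_of_exp_eq_sub (θ := fun t => θ (0, t)) (γ := g.extend) (α := α₁)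
    (β₀ := α₂ + 2 * Real.pi) (β₁ := α₄ + 2 * Real.pi) (by fun_prop) one_ne_zero
    (fun t => by rw [hexp', hf0, one_mul]) hg' (fun t => by rw [← hf0]; exact (hne' 0 t).symm)
    (hg0.trans (period _)) (hg1.trans (period _))
    (by linarith) (by linarith) (by linarith) (by linarith)
  have e₂ := im_sub_im_of_exp_eq_sub (θ := fun t => θ (1, t)) (γ := g.extend) (α := α₃)
    (β₀ := α₂) (β₁ := α₄ + 2 * Real.pi) (by fun_prop) one_ne_zero
    (fun t => by rw [hexp', hf1, one_mul]) hg' (fun t => by rw [← hf1]; exact (hne' 1 t).symm)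
    hg0 (hg1.trans (period _))
    (by linarith) (by linarith) (by linarith) (by linarith)
  have e₃ := im_sub_im_of_exp_eq_sub (θ := fun s => θ (s, 0)) (γ := f.extend) (α := α₂)
    (β₀ := α₁) (β₁ := α₃ + 2 * Real.pi) (by fun_prop) (neg_ne_zero.2 one_ne_zero)
    (fun t => by rw [hexp', hg0]; ring) hf' (fun t => by rw [← hg0]; exact hne' t 0)
    hf0 (hf1.trans (period _))
    (by linarith) (by linarith) (by linarith) (by linarith)
  have e₄ := im_sub_im_of_exp_eq_sub (θ := fun s => θ (s, 1)) (γ := f.extend) (α := α₄)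
    (β₀ := α₁) (β₁ := α₃) (by fun_prop) (neg_ne_zero.2 one_ne_zero)
    (fun t => by rw [hexp', hg1]; ring) hf' (fun t => by rw [← hg1]; exact hne' t 1)
    hf0 hf1
    (by linarith) (by linarith) (by linarith) (by linarith)
  -- The two routes from `(0, 0)` to `(1, 1)` give changes of argument that differ by `2π`.
  linarith [Real.pi_pos]

end Complex

/-! ### Walks and their weights -/

namespace WeightedDag

variable {V : Type*}

/-- The list `l` is a walk from `u` to `v`. -/
structure IsWalk (G : WeightedDag V) (u v : V) (l : List V) : Prop where
  isChain : l.IsChain G.Adj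
  head_eq : l.head? = some u
  last_eq : l.getLast? = some v

variable {G : WeightedDag V}

/-- A repeated vertex would close a directed cycle. Tails can therefore be exchanged without
checking that the resulting vertices are distinct. -/
theorem IsWalk.nodup {u v : V} {l : List V} (h : G.IsWalk u v l) : l.Nodup := by
  have hp : l.Pairwise (Relation.TransGen G.Adj) :=
    List.isChain_iff_pairwise.1 (h.isChain.imp fun _ _ => Relation.TransGen.single)
  refine hp.imp fun {a b} hab hne => ?_
  subst hne
  exact G.acyclic a hab

/-- Walks in an acyclic graph are paths. -/
def IsWalk.toDiPath {u v : V} {l : List V} (h : G.IsWalk u v l) : G.DiPath u v :=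
  ⟨l, h.nodup, h.isChain, h.head_eq, h.last_eq⟩

theorem DiPath.isWalk {u v : V} (π : G.DiPath u v) : G.IsWalk u v π.verts :=
  ⟨π.isChain, π.head_eq, π.last_eq⟩

theorem IsWalk.head_mem {u v : V} {l : List V} (h : G.IsWalk u v l) : u ∈ l :=
  List.mem_of_mem_head? h.head_eq

theorem IsWalk.last_mem {u v : V} {l : List V} (h : G.IsWalk u v l) : v ∈ l :=
  List.mem_of_getLast? h.last_eq

theorem isWalk_append_cons_iff {u v x : V} {l₁ l₂ : List V} :
    G.IsWalk u v (l₁ ++ x :: l₂) ↔ G.IsWalk u x (l₁ ++ [x]) ∧ G.IsWalk x v (x :: l₂) := by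
  constructor
  · rintro ⟨h₁, h₂, h₃⟩
    obtain ⟨h₄, h₅⟩ := List.isChain_split.1 h₁
    refine ⟨⟨h₄, ?_, by simp⟩, ⟨h₅, by simp, ?_⟩⟩
    · cases l₁ <;> simpa using h₂
    · simpa [List.getLast?_append] using h₃
  · rintro ⟨⟨h₁, h₂, -⟩, ⟨h₃, -, h₄⟩⟩
    refine ⟨List.isChain_split.2 ⟨h₁, h₃⟩, ?_, ?_⟩
    · cases l₁ <;> simpa using h₂
    · simpa [List.getLast?_append] using h₄

/-- The weight of a list of vertices: the product of the weights of its steps. -/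
def listWt (G : WeightedDag V) (l : List V) : ℝ :=
  (List.zipWith G.weight l l.tail).prod

@[simp] theorem listWt_nil : G.listWt [] = 1 := rfl

@[simp] theorem listWt_singleton (a : V) : G.listWt [a] = 1 := rfl

@[simp] theorem listWt_cons_cons (a b : V) (l : List V) :
    G.listWt (a :: b :: l) = G.weight a b * G.listWt (b :: l) := rfl

theorem listWt_append_cons (l₁ l₂ : List V) (x : V) :
    G.listWt (l₁ ++ x :: l₂) = G.listWt (l₁ ++ [x]) * G.listWt (x :: l₂) := by
  induction l₁ with
  | nil => simp
  | cons a l ih =>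
    cases l with
    | nil => simp
    | cons b l => simpa [mul_assoc] using Or.inl ih

theorem listWt_nonneg {l : List V} (h : l.IsChain G.Adj) : 0 ≤ G.listWt l := by
  induction h with
  | nil => simp
  | singleton => simp
  | cons_cons h _ ih => simpa using mul_nonneg (G.weight_pos _ _ h).le ih

/-- The finite set of walks from `u` to `v`. -/
noncomputable def walks [Finite V] (G : WeightedDag V) (u v : V) : Finset (List V) :=
  (Finset.univ : Finset (G.DiPath u v)).map
    ⟨DiPath.verts, fun _ _ h => DiPath.ext h⟩

@[simp] theorem mem_walks [Finite V] {u v : V} {l : List V} :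
    l ∈ G.walks u v ↔ G.IsWalk u v l := by
  simp only [walks, Finset.mem_map, Finset.mem_univ, true_and]
  exact ⟨fun ⟨π, h⟩ => h ▸ π.isWalk, fun h => ⟨h.toDiPath, rfl⟩⟩

theorem sum_wt_eq_sum_walks [Finite V] (u v : V) :
    ∑ π : G.DiPath u v, π.wt = ∑ l ∈ G.walks u v, G.listWt l := by
  simp only [walks, Finset.sum_map]
  rfl

/-! ### From crossing curves to common vertices -/

namespace DiscEmbedding

/-- The part of the drawing spanned by the vertices in `A`. -/
def drawing (e : G.DiscEmbedding) (A : Set V) : Set ℂ :=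
  {z | (∃ v ∈ A, z = e.pos v) ∨
    ∃ u ∈ A, ∃ v ∈ A, ∃ (h : G.Adj u v) (x : I), 0 < x ∧ x < 1 ∧ z = e.arc u v h x}

variable (e : G.DiscEmbedding)

theorem drawing_mono {A B : Set V} (h : A ⊆ B) : e.drawing A ⊆ e.drawing B := by
  rintro z (⟨v, hv, hz⟩ | ⟨u, hu, v, hv, hz⟩)
  exacts [Or.inl ⟨v, h hv, hz⟩, Or.inr ⟨u, h hu, v, h hv, hz⟩]

theorem pos_mem_drawing {A : Set V} {v : V} (hv : v ∈ A) : e.pos v ∈ e.drawing A :=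
  Or.inl ⟨v, hv, rfl⟩

theorem norm_le_of_mem_drawing {A : Set V} {z : ℂ} (hz : z ∈ e.drawing A) : ‖z‖ ≤ 1 := by
  rcases hz with ⟨v, -, rfl⟩ | ⟨u, -, v, -, h, x, h₀, h₁, rfl⟩
  exacts [e.norm_pos_le v, (e.norm_arc_lt u v h x h₀ h₁).le]

/-- Arcs with a common interior point belong to the same edge, so they share their initial vertex;
this turns an intersection in the plane into a common vertex. -/
theorem disjoint_drawing {A B : Set V} (h : Disjoint A B) :
    Disjoint (e.drawing A) (e.drawing B) := by
  rw [Set.disjoint_left] at h ⊢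
  rintro z (⟨v, hv, hz⟩ | ⟨u, hu, v, hv, huv, x, h₀, h₁, hz⟩)
    (⟨v', hv', hz'⟩ | ⟨u', hu', v', hv', huv', x', h₀', h₁', hz'⟩)
  · exact h hv (e.pos_injective (hz.symm.trans hz') ▸ hv')
  · exact e.arc_ne_pos _ _ huv' _ h₀' h₁' _ (hz'.symm.trans hz)
  · exact e.arc_ne_pos _ _ huv _ h₀ h₁ _ (hz.symm.trans hz')
  · exact h hu ((e.arc_disjoint _ _ huv _ _ huv' _ _ h₀ h₁ h₀' h₁' (hz.symm.trans hz')).1 ▸ hu')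

theorem arc_mem_drawing {A : Set V} {u v : V} (hu : u ∈ A) (hv : v ∈ A) (h : G.Adj u v) (x : I) :
    e.arc u v h x ∈ e.drawing A := by
  rcases (unitInterval.nonneg' (t := x)).eq_or_lt with rfl | h₀
  · rw [Path.source]
    exact e.pos_mem_drawing hu
  rcases (unitInterval.le_one' (t := x)).eq_or_lt with rfl | h₁
  · rw [Path.target]
    exact e.pos_mem_drawing hv
  exact Or.inr ⟨u, hu, v, hv, h, x, h₀, h₁, rfl⟩

theorem joinedIn_drawing {u v : V} {l : List V} (h : G.IsWalk u v l) :
    JoinedIn (e.drawing {w | w ∈ l}) (e.pos u) (e.pos v) := by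
  induction l generalizing u with
  | nil => simpa using h.head_eq
  | cons a l ih =>
    obtain rfl : a = u := by simpa using h.head_eq
    cases l with
    | nil =>
      obtain rfl : a = v := by simpa using h.last_eq
      exact JoinedIn.refl (e.pos_mem_drawing (by simp))
    | cons b l =>
      obtain ⟨hab, hc⟩ := List.isChain_cons_cons.1 h.isChain
      have hw : G.IsWalk b v (b :: l) := ⟨hc, rfl, by simpa using h.last_eq⟩
      refine JoinedIn.trans ⟨e.arc a b hab, fun x => ?_⟩
        ((ih hw).mono (e.drawing_mono fun w hw => List.mem_cons_of_mem _ hw))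
      exact e.arc_mem_drawing (by simp) (by simp) hab x

/-- Two walks whose ends alternate on the unit circle share a vertex. -/
theorem exists_mem_of_alternating_ends {u₁ u₂ v₁ v₂ : V} {l₁ l₂ : List V}
    (h₁ : G.IsWalk u₁ v₁ l₁) (h₂ : G.IsWalk u₂ v₂ l₂) {α₁ α₂ β₁ β₂ : ℝ}
    (hu₁ : e.pos u₁ = Complex.exp (α₁ * Complex.I))
    (hu₂ : e.pos u₂ = Complex.exp (α₂ * Complex.I))
    (hv₁ : e.pos v₁ = Complex.exp (β₁ * Complex.I))
    (hv₂ : e.pos v₂ = Complex.exp (β₂ * Complex.I))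
    (hα : α₂ < α₁) (hαβ : β₁ < α₂) (hβ : β₂ < β₁) (hβα : α₁ - 2 * Real.pi < β₂) :
    ∃ w, w ∈ l₁ ∧ w ∈ l₂ := by
  by_contra! hne
  obtain ⟨f, hf⟩ := e.joinedIn_drawing h₁
  obtain ⟨g, hg⟩ := e.joinedIn_drawing h₂
  obtain ⟨x, y, hxy⟩ := Complex.exists_eq_of_alternating_ends hα hαβ hβ hβα
    (f.cast hu₁.symm hv₁.symm) (g.cast hu₂.symm hv₂.symm)
    (fun x => e.norm_le_of_mem_drawing (hf x)) (fun x => e.norm_le_of_mem_drawing (hg x))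
  have hd : Disjoint {w | w ∈ l₁} {w | w ∈ l₂} := Set.disjoint_left.2 hne
  exact Set.disjoint_left.1 (e.disjoint_drawing hd) (hf x) (by
    have : f x = g y := hxy
    rw [this]
    exact hg y)

end DiscEmbedding

end WeightedDag

/-! ### Splicing lists at an element -/

namespace List

variable {α : Type*}

theorem exists_dropWhile_eq_cons {P : α → Bool} {l : List α} (h : ∃ y ∈ l, P y = false) :
    ∃ x l', l.dropWhile P = x :: l' ∧ P x = false := by
  induction l with
  | nil => simp at h
  | cons a l ih =>
    by_cases ha : P a
    · rw [dropWhile_cons_of_pos ha]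
      exact ih (by simpa [ha] using h)
    · exact ⟨a, l, dropWhile_cons_of_neg ha, by simpa using ha⟩

theorem takeWhile_dropWhile_eq_nil (P : α → Bool) (l : List α) :
    (l.dropWhile P).takeWhile P = [] := by
  induction l with
  | nil => rfl
  | cons a l ih => by_cases ha : P a <;> simp [ha, ih]

theorem takeWhile_takeWhile_append_dropWhile (P : α → Bool) (l l' : List α) :
    (l.takeWhile P ++ l'.dropWhile P).takeWhile P = l.takeWhile P := by
  rw [takeWhile_append_of_pos fun _ => mem_takeWhile_imp, takeWhile_dropWhile_eq_nil, append_nil]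

theorem dropWhile_takeWhile_append_dropWhile (P : α → Bool) (l l' : List α) :
    (l.takeWhile P ++ l'.dropWhile P).dropWhile P = l'.dropWhile P := by
  refine append_cancel_left (as := l.takeWhile P) ?_
  conv_lhs =>
    lhs
    rw [← takeWhile_takeWhile_append_dropWhile P l l']
  rw [takeWhile_append_dropWhile]

variable [DecidableEq α]

/-- The list that follows `l` up to the first occurrence of `x`, and `l'` from there on. -/
def splice (x : α) (l l' : List α) : List α :=
  l.takeWhile (· ≠ x) ++ l'.dropWhile (· ≠ x)

-- This holds even if `x` does not occur: the first piece is then all of `l` and the second is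
-- empty. Members of a family that a swap fixes are thus unchanged.
@[simp] theorem splice_self (x : α) (l : List α) : splice x l l = l :=
  takeWhile_append_dropWhile

theorem splice_splice (x : α) (l₁ l₂ l₃ l₄ : List α) :
    splice x (splice x l₁ l₂) (splice x l₃ l₄) = splice x l₁ l₄ := by
  unfold splice
  rw [takeWhile_takeWhile_append_dropWhile, dropWhile_takeWhile_append_dropWhile]

theorem count_splice (x v : α) (l l' : List α) :
    (splice x l l').count v =
      (l.takeWhile (· ≠ x)).count v + (l'.dropWhile (· ≠ x)).count v :=
  count_append

theorem exists_dropWhile_ne_eq_cons {x : α} {l : List α} (h : x ∈ l) :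
    ∃ l', l.dropWhile (· ≠ x) = x :: l' := by
  obtain ⟨y, l', h₁, h₂⟩ := exists_dropWhile_eq_cons (P := (· ≠ x)) ⟨x, h, by simp⟩
  obtain rfl : y = x := by simpa using h₂
  exact ⟨l', h₁⟩

theorem mem_splice {x : α} {l l' : List α} : x ∈ splice x l l' ↔ x ∈ l' := by
  have h₁ : ∀ l : List α, x ∉ l.takeWhile (· ≠ x) := fun l h => by
    simpa using mem_takeWhile_imp h
  rw [splice, mem_append, or_iff_right (h₁ l)]
  conv_rhs => rw [← takeWhile_append_dropWhile (p := (· ≠ x)) (l := l'), mem_append,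
    or_iff_right (h₁ l')]

end List

/-! ### Tail exchange and the Lindström–Gessel–Viennot lemma -/

namespace WeightedDag

variable {V : Type*} {G : WeightedDag V}

section Splice

variable [DecidableEq V]

theorem IsWalk.splice {u v u' v' x : V} {l l' : List V} (h : G.IsWalk u v l)
    (h' : G.IsWalk u' v' l') (hx : x ∈ l) (hx' : x ∈ l') : G.IsWalk u v' (l.splice x l') := by
  obtain ⟨r, hr⟩ := List.exists_dropWhile_ne_eq_cons hx
  obtain ⟨r', hr'⟩ := List.exists_dropWhile_ne_eq_cons hx'
  rw [← l.splice_self x, List.splice, hr, isWalk_append_cons_iff] at h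
  rw [← l'.splice_self x, List.splice, hr', isWalk_append_cons_iff] at h'
  rw [List.splice, hr', isWalk_append_cons_iff]
  exact ⟨h.1, h'.2⟩

theorem listWt_splice {x : V} (l : List V) {l' : List V} (hx' : x ∈ l') :
    G.listWt (l.splice x l') =
      G.listWt (l.takeWhile (· ≠ x) ++ [x]) * G.listWt (l'.dropWhile (· ≠ x)) := by
  obtain ⟨r', hr'⟩ := List.exists_dropWhile_ne_eq_cons hx'
  rw [List.splice, hr', listWt_append_cons]

end Splice

/-! ### Families of walks -/

section Families

variable {ι : Type*} [Fintype ι] [DecidableEq V]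

/-- The number of visits of the family `p` to `v`. -/
def visits (p : ι → List V) (v : V) : ℕ := ∑ i, (p i).count v

theorem exists_mem_mem_of_two_le_visits {p : ι → List V} (hp : ∀ i, (p i).Nodup) {v : V}
    (h : 2 ≤ visits p v) : ∃ i j, i ≠ j ∧ v ∈ p i ∧ v ∈ p j := by
  classical
  by_contra! hne
  have hle : ∀ i, (p i).count v ≤ 1 := fun i => List.nodup_iff_count_le_one.1 (hp i) v
  by_cases hv : ∃ i, v ∈ p i
  · obtain ⟨i, hi⟩ := hv
    have : visits p v = (p i).count v := Finset.sum_eq_single i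
      (fun j _ hj => List.count_eq_zero.2 (hne i j hj.symm hi)) (by simp)
    have := hle i
    omega
  · push Not at hv
    have : visits p v = 0 := Finset.sum_eq_zero fun i _ => List.count_eq_zero.2 (hv i)
    omega

theorem two_le_visits {p : ι → List V} {v : V} {i j : ι} (hij : i ≠ j) (hi : v ∈ p i)
    (hj : v ∈ p j) : 2 ≤ visits p v := by
  classical
  calc 2 ≤ (p i).count v + (p j).count v :=
        Nat.add_le_add (List.count_pos_iff.2 hi) (List.count_pos_iff.2 hj)
    _ = ∑ k ∈ {i, j}, (p k).count v := (Finset.sum_pair (f := fun k => (p k).count v) hij).symm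
    _ ≤ visits p v := Finset.sum_le_sum_of_subset (Finset.subset_univ _)

/-- Two members of the family `p` meet. -/
def Meets (p : ι → List V) : Prop := ∃ v, 2 ≤ visits p v

variable [DecidableEq ι]

/-- `τ` exchanges two members of the family `p` that visit `x`. -/
def IsSwapAt (p : ι → List V) (x : V) (τ : Equiv.Perm ι) : Prop :=
  ∃ i j, i ≠ j ∧ x ∈ p i ∧ x ∈ p j ∧ τ = Equiv.swap i j

/-- The family obtained from `p` by permuting the tails that start at `x`. -/
def permuteTails (p : ι → List V) (x : V) (τ : Equiv.Perm ι) : ι → List V :=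
  fun i => (p i).splice x (p (τ i))

namespace IsSwapAt

variable {ι : Type*} [DecidableEq ι] {p : ι → List V} {x : V} {τ : Equiv.Perm ι} (h : IsSwapAt p x τ)

include h

omit [DecidableEq V] in
theorem mul_self : τ * τ = 1 := by
  obtain ⟨i, j, -, -, -, rfl⟩ := h
  exact Equiv.swap_mul_self i j

omit [DecidableEq V] in
theorem ne_one : τ ≠ 1 := by
  obtain ⟨i, j, hij, -, -, rfl⟩ := h
  exact fun e => hij (Equiv.swap_eq_one_iff.1 e)

omit [DecidableEq V] in
theorem sign_eq [Fintype ι] : Equiv.Perm.sign τ = -1 := by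
  obtain ⟨i, j, hij, -, -, rfl⟩ := h
  exact Equiv.Perm.sign_swap hij

omit [DecidableEq V] in
theorem mem_or_eq (k : ι) : x ∈ p k ∧ x ∈ p (τ k) ∨ τ k = k := by
  obtain ⟨i, j, hij, hi, hj, rfl⟩ := h
  rcases eq_or_ne k i with rfl | hki
  · exact Or.inl ⟨hi, by rwa [Equiv.swap_apply_left]⟩
  rcases eq_or_ne k j with rfl | hkj
  · exact Or.inl ⟨hj, by rwa [Equiv.swap_apply_right]⟩
  · exact Or.inr (Equiv.swap_apply_of_ne_of_ne hki hkj)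

theorem mem_permuteTails (k : ι) : x ∈ permuteTails p x τ k ↔ x ∈ p k := by
  rw [permuteTails, List.mem_splice]
  rcases h.mem_or_eq k with ⟨h₁, h₂⟩ | h₁
  · exact iff_of_true h₂ h₁
  · rw [h₁]

/-- The predicate depends only on which members visit `x`, and a swap of tails at `x` preserves
this. The choice in `meetingSwap` is thus the same before and after the exchange. -/
theorem isSwapAt_permuteTails_iff (τ' : Equiv.Perm ι) :
    IsSwapAt (permuteTails p x τ) x τ' ↔ IsSwapAt p x τ' := by
  simp only [IsSwapAt, h.mem_permuteTails]

theorem permuteTails_permuteTails : permuteTails (permuteTails p x τ) x τ = p := by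
  funext k
  have : τ (τ k) = k := congrArg (fun ρ : Equiv.Perm ι => ρ k) h.mul_self
  rw [permuteTails, permuteTails, permuteTails, List.splice_splice, this, List.splice_self]

theorem isWalk_permuteTails {s t : ι → V} {ρ : Equiv.Perm ι}
    (hp : ∀ i, G.IsWalk (s i) (t (ρ i)) (p i)) (k : ι) :
    G.IsWalk (s k) (t ((ρ * τ) k)) (permuteTails p x τ k) := by
  rw [permuteTails, Equiv.Perm.mul_apply]
  rcases h.mem_or_eq k with ⟨h₁, h₂⟩ | h₁
  · exact (hp k).splice (hp (τ k)) h₁ h₂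
  · rw [h₁, List.splice_self]
    exact hp k

theorem prod_listWt_permuteTails [Fintype ι] :
    ∏ k, G.listWt (permuteTails p x τ k) = ∏ k, G.listWt (p k) := by
  -- Each weight splits into a head factor `A` and a tail factor `B`; the exchange only permutes the
  -- tail factors.
  let A : ι → ℝ := fun k =>
    if x ∈ p k then G.listWt ((p k).takeWhile (· ≠ x) ++ [x]) else G.listWt (p k)
  let B : ι → ℝ := fun k => if x ∈ p k then G.listWt ((p k).dropWhile (· ≠ x)) else 1
  have h₁ : ∀ k, G.listWt (p k) = A k * B k := fun k => by
    by_cases hk : x ∈ p k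
    · simp only [A, B, if_pos hk, ← listWt_splice (p k) hk, List.splice_self]
    · simp only [A, B, if_neg hk, mul_one]
  have h₂ : ∀ k, G.listWt (permuteTails p x τ k) = A k * B (τ k) := fun k => by
    rcases h.mem_or_eq k with ⟨hk, hk'⟩ | hk
    · simp only [A, B, if_pos hk, if_pos hk', permuteTails, listWt_splice _ hk']
    · rw [permuteTails, hk, List.splice_self, h₁]
  simp only [h₁, h₂, Finset.prod_mul_distrib, Equiv.prod_comp τ B]

end IsSwapAt

-- Tails are permuted, not altered, so all visits are conserved. As `meetingVertex` is chosen from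
-- the visit counts alone, the exchange does not move it.
omit [DecidableEq ι] in
theorem visits_permuteTails (p : ι → List V) (x : V) (τ : Equiv.Perm ι) :
    visits (permuteTails p x τ) = visits p := by
  funext v
  simp only [visits, permuteTails, List.count_splice, Finset.sum_add_distrib]
  rw [Equiv.sum_comp τ fun k => ((p k).dropWhile (· ≠ x)).count v, ← Finset.sum_add_distrib]
  simp only [← List.count_splice, List.splice_self]

/-- A vertex at which two members of a meeting family meet. -/
noncomputable def meetingVertex [Nonempty V] (p : ι → List V) : V :=
  Classical.epsilon fun v => 2 ≤ visits p v

/-- A transposition of two members of a meeting family that visit its meeting vertex. -/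
noncomputable def meetingSwap [Nonempty V] (p : ι → List V) : Equiv.Perm ι :=
  Classical.epsilon (IsSwapAt p (meetingVertex p))

theorem Meets.isSwapAt_meetingSwap [Nonempty V] {p : ι → List V} (h : Meets p)
    (hp : ∀ i, (p i).Nodup) : IsSwapAt p (meetingVertex p) (meetingSwap p) := by
  obtain ⟨i, j, hij, hi, hj⟩ := exists_mem_mem_of_two_le_visits hp (Classical.epsilon_spec h)
  exact Classical.epsilon_spec (p := IsSwapAt p (meetingVertex p)) ⟨_, i, j, hij, hi, hj, rfl⟩

variable [Finite V]

/-- The families of walks that connect the `s i` to the `t (ρ i)`, where `ρ` is a permutation. -/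
noncomputable def walkFamilies (G : WeightedDag V) (s t : ι → V) :
    Finset (Σ _ : Equiv.Perm ι, ι → List V) :=
  Finset.univ.sigma fun ρ => Fintype.piFinset fun i => G.walks (s i) (t (ρ i))

omit [DecidableEq V] in
theorem mem_walkFamilies {s t : ι → V} {a : Σ _ : Equiv.Perm ι, ι → List V} :
    a ∈ G.walkFamilies s t ↔ ∀ i, G.IsWalk (s i) (t (a.1 i)) (a.2 i) := by
  simp [walkFamilies]

open Classical in
/-- The Lindström–Gessel–Viennot lemma. -/
theorem det_sum_walks [Nonempty V] (s t : ι → V) :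
    (Matrix.of fun i j => ∑ l ∈ G.walks (s i) (t j), G.listWt l).det =
      ∑ a ∈ (G.walkFamilies s t).filter fun a => ¬ Meets a.2,
        ((Equiv.Perm.sign a.1 : ℤ) : ℝ) * ∏ i, G.listWt (a.2 i) := by
  -- The transpose makes the permutation act on the sinks, as in `walkFamilies`.
  rw [← Matrix.det_transpose, Matrix.det_apply']
  simp only [Matrix.transpose_apply, Matrix.of_apply, Finset.prod_univ_sum, Finset.mul_sum]
  rw [Finset.sum_sigma']
  change ∑ a ∈ G.walkFamilies s t, ((Equiv.Perm.sign a.1 : ℤ) : ℝ) * ∏ i, G.listWt (a.2 i) = _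
  rw [← Finset.sum_filter_add_sum_filter_not (G.walkFamilies s t) (fun a => Meets a.2),
    add_eq_right]
  have hswap : ∀ a ∈ (G.walkFamilies s t).filter (fun a => Meets a.2),
      IsSwapAt a.2 (meetingVertex a.2) (meetingSwap a.2) := fun a ha => by
    rw [Finset.mem_filter, mem_walkFamilies] at ha
    exact ha.2.isSwapAt_meetingSwap fun i => (ha.1 i).nodup
  refine Finset.sum_involution
    (fun a _ => ⟨a.1 * meetingSwap a.2, permuteTails a.2 (meetingVertex a.2) (meetingSwap a.2)⟩)
    (fun a ha => ?_) (fun a ha _ => ?_) (fun a ha => ?_) (fun a ha => ?_)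
  · simp only [Equiv.Perm.sign_mul, (hswap a ha).sign_eq, (hswap a ha).prod_listWt_permuteTails]
    push_cast
    ring
  · exact fun e => (hswap a ha).ne_one (mul_eq_left.1 (congrArg Sigma.fst e))
  · rw [Finset.mem_filter, mem_walkFamilies] at ha ⊢
    have := hswap a (by rw [Finset.mem_filter, mem_walkFamilies]; exact ha)
    refine ⟨this.isWalk_permuteTails ha.1, ?_⟩
    rw [Meets, visits_permuteTails]
    exact ha.2
  -- Applying the exchange twice restores the family because both choices are repeated:
  -- `Classical.epsilon` depends only on the predicate, and each predicate is invariant.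
  · have h₁ : meetingVertex (permuteTails a.2 (meetingVertex a.2) (meetingSwap a.2)) =
        meetingVertex a.2 := by
      rw [meetingVertex, visits_permuteTails, meetingVertex]
    have h₂ : meetingSwap (permuteTails a.2 (meetingVertex a.2) (meetingSwap a.2)) =
        meetingSwap a.2 := by
      rw [meetingSwap, h₁]
      conv_rhs => rw [meetingSwap]
      exact congrArg _ (funext fun τ => propext ((hswap a ha).isSwapAt_permuteTails_iff τ))
    simp only [h₁, h₂]
    rw [(hswap a ha).permuteTails_permuteTails, mul_assoc, (hswap a ha).mul_self, mul_one]

theorem det_sum_walks_nonneg [Nonempty V] {s t : ι → V}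
    (h : ∀ (ρ : Equiv.Perm ι) (p : ι → List V), (∀ i, G.IsWalk (s i) (t (ρ i)) (p i)) →
      (∀ i j, i ≠ j → (p i).Disjoint (p j)) → ρ = 1) :
    0 ≤ (Matrix.of fun i j => ∑ l ∈ G.walks (s i) (t j), G.listWt l).det := by
  classical
  rw [det_sum_walks]
  refine Finset.sum_nonneg fun a ha => ?_
  rw [Finset.mem_filter, mem_walkFamilies] at ha
  rw [h a.1 a.2 ha.1 fun i j hij v hi hj => ha.2 ⟨v, two_le_visits hij hi hj⟩]
  simpa using Finset.prod_nonneg fun i _ => listWt_nonneg (ha.1 i).isChain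

end Families

end WeightedDag

/-! ### Factorization through a bottleneck -/

namespace WeightedDag

variable {V : Type*} {G : WeightedDag V} [Finite V]

/-- Each walk is cut at its first vertex `u` in `U`. The filter keeps the initial pieces that meet
`U` only at their end, which makes the cut unique. -/
theorem sum_walks_eq_sum_mul [DecidableEq V] (U : Finset V) {s t : V}
    (h : ∀ l, G.IsWalk s t l → ∃ v ∈ l, v ∈ U) :
    ∑ l ∈ G.walks s t, G.listWt l =
      ∑ u ∈ U, (∑ l ∈ (G.walks s u).filter (fun l => l.takeWhile (· ∉ U) ++ [u] = l),
        G.listWt l) * ∑ l ∈ G.walks u t, G.listWt l := by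
  have hmaps : ∀ l ∈ G.walks s t,
      (l.dropWhile (· ∉ U)).head? ∈ U.map Function.Embedding.some := fun l hl => by
    obtain ⟨v, hv, hvU⟩ := h l (mem_walks.1 hl)
    obtain ⟨x, r, hr, hx⟩ := List.exists_dropWhile_eq_cons (P := (· ∉ U)) ⟨v, hv, by simpa⟩
    rw [hr]
    simpa using hx
  rw [← Finset.sum_fiberwise_of_maps_to hmaps, Finset.sum_map]
  refine Finset.sum_congr rfl fun u hu => ?_
  have htake : ∀ l r : List V, (l.takeWhile (· ∉ U) ++ u :: r).takeWhile (· ∉ U) =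
      l.takeWhile (· ∉ U) := fun l r => by
    rw [List.takeWhile_append_of_pos fun _ => List.mem_takeWhile_imp]
    simp [hu]
  have hdrop : ∀ l r : List V, (l.takeWhile (· ∉ U) ++ u :: r).dropWhile (· ∉ U) = u :: r :=
    fun l r => by
    rw [List.dropWhile_append_of_pos fun _ => List.mem_takeWhile_imp]
    simp [hu]
  rw [Finset.sum_mul_sum, ← Finset.sum_product']
  have hleft : ∀ l ∈ (G.walks s t).filter
      (fun l => (l.dropWhile (· ∉ U)).head? = Function.Embedding.some u),
      ∃ r, l.dropWhile (· ∉ U) = u :: r ∧ G.IsWalk s u (l.takeWhile (· ∉ U) ++ [u]) ∧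
        G.IsWalk u t (u :: r) := fun l hl => by
    rw [Finset.mem_filter, mem_walks] at hl
    obtain ⟨r, hr⟩ := List.head?_eq_some_iff.1 hl.2
    have := hl.1
    rw [← List.takeWhile_append_dropWhile (p := (· ∉ U)) (l := l), hr,
      isWalk_append_cons_iff] at this
    exact ⟨r, hr, this⟩
  have hright : ∀ x ∈ (G.walks s u).filter (fun l => l.takeWhile (· ∉ U) ++ [u] = l) ×ˢ
      G.walks u t, x.1.takeWhile (· ∉ U) ++ [u] = x.1 ∧ ∃ r, x.2 = u :: r ∧
        G.IsWalk s t (x.1.takeWhile (· ∉ U) ++ u :: r) := fun x hx => by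
    rw [Finset.mem_product, Finset.mem_filter, mem_walks, mem_walks] at hx
    obtain ⟨r, hr⟩ := List.head?_eq_some_iff.1 hx.2.head_eq
    refine ⟨hx.1.2, r, hr, isWalk_append_cons_iff.2 ⟨?_, hr ▸ hx.2⟩⟩
    rw [hx.1.2]
    exact hx.1.1
  refine Finset.sum_nbij' (fun l => (l.takeWhile (· ∉ U) ++ [u], l.dropWhile (· ∉ U)))
    (fun x => x.1.takeWhile (· ∉ U) ++ x.2) (fun l hl => ?_) (fun x hx => ?_)
    (fun l hl => ?_) (fun x hx => ?_) (fun l hl => ?_)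
  · obtain ⟨r, hr, h₁, h₂⟩ := hleft l hl
    rw [Finset.mem_product, Finset.mem_filter, mem_walks, mem_walks]
    exact ⟨⟨h₁, by rw [htake]⟩, by rw [hr]; exact h₂⟩
  · obtain ⟨-, r, hr, h₁⟩ := hright x hx
    rw [Finset.mem_filter, mem_walks, hr, hdrop]
    exact ⟨h₁, rfl⟩
  · simp only [htake]
    exact List.takeWhile_append_dropWhile
  · obtain ⟨h₀, r, hr, h₁⟩ := hright x hx
    simp only [hr, htake, hdrop, h₀]
    rw [← hr]
  · obtain ⟨r, hr, -⟩ := hleft l hl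
    conv_lhs => rw [← List.takeWhile_append_dropWhile (p := (· ∉ U)) (l := l), hr]
    rw [listWt_append_cons, hr]

/-- The matrix of walk sums has rank at most the size of a set that every walk meets. -/
theorem rank_sum_walks_le {m n : Type*} [Fintype m] [Fintype n] (s : m → V) (t : n → V)
    (U : Finset V) (h : ∀ i j l, G.IsWalk (s i) (t j) l → ∃ v ∈ l, v ∈ U) :
    (Matrix.of fun i j => ∑ l ∈ G.walks (s i) (t j), G.listWt l).rank ≤ U.card := by
  classical
  let A : Matrix m U ℝ := Matrix.of fun i u =>
    ∑ l ∈ (G.walks (s i) u).filter (fun l => l.takeWhile (· ∉ U) ++ [u.1] = l), G.listWt l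
  let B : Matrix U n ℝ := Matrix.of fun u j => ∑ l ∈ G.walks u (t j), G.listWt l
  have hAB : (Matrix.of fun i j => ∑ l ∈ G.walks (s i) (t j), G.listWt l) = A * B := by
    ext i j
    rw [Matrix.mul_apply, Matrix.of_apply, sum_walks_eq_sum_mul U (h i j),
      ← Finset.sum_coe_sort U]
    rfl
  rw [hAB]
  exact (Matrix.rank_mul_le_left A B).trans
    ((Matrix.rank_le_card_width A).trans_eq (Fintype.card_coe U))

end WeightedDag

/-! ### The path matrix -/

namespace Network

variable {V : Type*} [Finite V] {k : ℕ} (N : Network V k)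

theorem pathMatrix_apply (i j : Fin (2 * k - 1)) :
    N.pathMatrix i j = ∑ l ∈ N.walks (N.source i) (N.sink j), N.listWt l :=
  WeightedDag.sum_wt_eq_sum_walks _ _

theorem isTotallyNonneg_pathMatrix : IsTotallyNonneg N.pathMatrix := by
  classical
  intro r f g hf hg
  obtain ⟨a, b, ha, hb, ha_anti, hb_mono, hba, hab⟩ := N.clockwise
  -- Repeated sources or sinks give equal rows or columns. Otherwise the weak inequalities between
  -- arguments within each of the two tuples become strict.
  by_cases hs : Function.Injective fun i => N.source (f i)
  swap
  · obtain ⟨i, j, hij, hne⟩ : ∃ i j, N.source (f i) = N.source (f j) ∧ i ≠ j := by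
      simpa [Function.Injective] using hs
    refine (Matrix.det_zero_of_row_eq hne (funext fun l => ?_)).ge
    simp only [Matrix.submatrix_apply, pathMatrix_apply, hij]
  by_cases ht : Function.Injective fun i => N.sink (g i)
  swap
  · obtain ⟨i, j, hij, hne⟩ : ∃ i j, N.sink (g i) = N.sink (g j) ∧ i ≠ j := by
      simpa [Function.Injective] using ht
    refine (Matrix.det_zero_of_column_eq hne fun l => ?_).ge
    simp only [Matrix.submatrix_apply, pathMatrix_apply, hij]
  rcases Nat.eq_zero_or_pos r with rfl | hr
  · simp
  have : Nonempty V := ⟨N.source (f ⟨0, hr⟩)⟩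
  have hM : N.pathMatrix.submatrix f g = Matrix.of fun i j =>
      ∑ l ∈ N.walks (N.source (f i)) (N.sink (g j)), N.listWt l := by
    ext i j
    exact N.pathMatrix_apply _ _
  rw [hM]
  refine WeightedDag.det_sum_walks_nonneg (s := fun i => N.source (f i))
    (t := fun i => N.sink (g i)) fun ρ p hp hdisj => ?_
  have hmono : StrictMono ρ := by
    intro i j hij
    by_contra hle
    have hne : ρ j ≠ ρ i := ρ.injective.ne hij.ne'
    have hlt : ρ j < ρ i := lt_of_le_of_ne (not_lt.1 hle) hne
    have h₁ : a (f j) < a (f i) := lt_of_le_of_ne (ha_anti (hf hij).le) fun e =>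
      hij.ne' (hs (N.embedding.pos_injective (by rw [ha, ha, e])))
    have h₂ : b (g (ρ j)) < b (g (ρ i)) := lt_of_le_of_ne (hb_mono (hg hlt).le) fun e =>
      hne (ht (N.embedding.pos_injective (by rw [hb, hb, e])))
    -- If a source coincides with a sink, here or in `h₄`, the two walks already share that vertex.
    have h₃ : b (g (ρ i)) < a (f j) := lt_of_le_of_ne (hba _ _) fun e => by
      have : N.sink (g (ρ i)) = N.source (f j) :=
        N.embedding.pos_injective (by rw [ha, hb, e])
      exact hdisj i j hij.ne (hp i).last_mem (this ▸ (hp j).head_mem)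
    have h₄ : a (f i) - 2 * Real.pi < b (g (ρ j)) := lt_of_le_of_ne (hab _ _) fun e => by
      have : N.source (f i) = N.sink (g (ρ j)) := by
        refine N.embedding.pos_injective ?_
        rw [ha, hb, ← e]
        push_cast
        rw [sub_mul, Complex.exp_sub, Complex.exp_two_pi_mul_I, div_one]
      exact hdisj i j hij.ne (hp i).head_mem (this ▸ (hp j).last_mem)
    obtain ⟨w, hw₁, hw₂⟩ := N.embedding.exists_mem_of_alternating_ends (hp i) (hp j)
      (ha _) (ha _) (hb _) (hb _) h₁ h₃ h₂ h₄
    exact hdisj i j hij.ne hw₁ hw₂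
  -- A finite linear order has no automorphism but the identity.
  have hid : hmono.orderIsoOfSurjective ρ ρ.surjective = OrderIso.refl _ := Subsingleton.elim _ _
  ext i
  exact congrArg Fin.val (DFunLike.congr_fun hid i)

end Network

theorem proposition4p2 {V : Type*} [Finite V] {k : ℕ} (hk : 2 ≤ k) (N : Network V k)
    (hN : N.IsInterlacing) : IsInterlacingMatrix k N.pathMatrix := by
  obtain ⟨⟨U, -, hU, hUN⟩, ⟨W, -, -, hW, hWN⟩⟩ := hN
  refine ⟨N.isTotallyNonneg_pathMatrix, le_trans ?_ hU, le_trans ?_ hW⟩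
  · convert! WeightedDag.rank_sum_walks_le N.source N.sink U
      fun i j l hl => hUN i j hl.toDiPath using 2
    ext i j
    exact N.pathMatrix_apply i j
  · convert! WeightedDag.rank_sum_walks_le N.source
      (fun j : {j : Fin (2 * k - 1) // IsMiddleIndex k j} => N.sink j.1) W
      fun i j l hl => hWN i j.1 j.2 hl.toDiPath using 2
    ext i j
    exact N.pathMatrix_apply i j
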